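/- **Parameters.** Let $q_1,q_2,q_3\in\mathbb C^\times$ with $q_1q_2q_3=1$ and $q_1^aq_2^b=1$ ($a,b\in\mathbb Z$) only for $a=b=0$. Fix logarithms with $\log q_1+\log q_2+\log q_3=0$, put $q_i^\alpha=e^{\alpha\log q_i}$, $s_i=q_i^{1/2}$, $\kappa_r=\prod_{i=1}^3(1-q_i^r)$, $c_1=\kappa_1/(s_1-s_1^{-1})$, $g(z,w)=\prod_{i=1}^3(z-q_iw)$, $\omega(x)=\frac{(1-q_2x)(1-q_3x)}{(1-x)(1-q_2q_3x)}$, $\delta(x)=\sum_{n\in\mathbb Z}x^n$. For a rational function $p$, $p^+$ and $p^-$ are its expansions at $0$ and $\infty$. Fix $\beta$ with $q_3=q_1^{-\beta}$ and put $\check\beta=2-\beta$. Let $(\check q_1,\check q_2,\check q_3)=(q_1^{-1},q_2,q_1^2q_3)$, with $\log\check q_1=-\log q_1$, $\log\check q_2=\log q_2$; checked quantities are formed from the $\check q_i$ as the unchecked ones from the $q_i$. **The algebra $\mathcal E_1[K]$ with $\psi_0=1$.** Generators: $e_k,f_k$ ($k\in\mathbb Z$), $h_r$ ($r\in\mathbb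 Z\setminus\{0\}$) and invertible central $C,K$. With $e(z)=\sum_k e_kz^{-k}$, $f(z)=\sum_k f_kz^{-k}$, $\psi^\pm(z)=\exp\bigl(\sum_{r>0}\kappa_rh_{\pm r}z^{\mp r}\bigr)$ the relations are $[h_r,h_s]=\delta_{r+s,0}\frac{C^r-C^{-r}}{r\kappa_r}$, $$g(C^{(1\pm1)/2}z,w)\psi^\pm(z)e(w)+g(w,C^{(1\pm1)/2}z)e(w)\psi^\pm(z)=0,$$ $$g(w,C^{(1\mp1)/2}z)\psi^\pm(z)f(w)+g(C^{(1\mp1)/2}z,w)f(w)\psi^\pm(z)=0,$$ $$[e(z),f(w)]=\kappa_1^{-1}\bigl(\delta(Cw/z)\psi^+(w)-\delta(Cz/w)\psi^-(z)\bigr),$$ $$g(z,w)e(z)e(w)+g(w,z)e(w)e(z)=0,\qquad g(w,z)f(z)f(w)+g(z,w)f(w)f(z)=0,$$ $$\mathrm{Sym}_{z_1,z_2,z_3}\,z_1z_2^2[e(z_1),[e(z_2),e(z_3)]]=0=\mathrm{Sym}_{z_1,z_2,z_3}\,z_1z_2^2[f(z_1),[f(z_2),f(z_3)]].$$ $\check{\mathcal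 E}_1[\check K]$ is the same algebra for the $\check q_i$, with generators $\check e_k,\check f_k,\check h_r,\check C,\check K$. On graded modules whose degrees are bounded above put, for $r\ge0$, $k_r^+(z)=(-c_1)^rf(q_1^{r-1}z)\cdots f(q_1z)f(z)\,k_0^+(z)$ and $k_r^-(z)=k_0^-(z)\,c_1^re(z)e(q_1z)\cdots e(q_1^{r-1}z)$, where $k_0^\pm(z)=K^{\pm1}\exp\bigl(\sum_{r>0}\frac{\kappa_r}{q_1^{\mp r}-1}h_{\pm r}z^{\mp r}\bigr)$. The products of currents $e$ (or $f$) are fused: for example, $e(z)e(q_1z)$ is the value of the Laurent polynomial $g(z,w)e(z)e(w)$ at $w=q_1z$, divided by $g(z,q_1z)$. **The algebras $\mathcal A_N$ and $\mathcal A_N^-$.** Let $N\in\mathbb Z$. The generators of $\mathcal A_N$ are those of $\mathcal E_1[K]$ and $\check{\mathcal E}_1[\check K]$, and $X^\pm_{i,k}$ with $k\in\mathbb Z$, where $i\in\mathbb Z$ for $X^-$ and $i\in\frac N2+\mathbb Z$ for $X^+$. For $\mathcal A_N^-$ the labels are instead $i\in\frac12+\mathbb Z$ for $X^-$ and $i\in\frac{N+1}2+\mathbb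 Z$ for $X^+$. Put $X_i^\pm(z)=\sum_kX^\pm_{i,k}z^{-k}$. The relations of both algebras are: 1. Those of $\mathcal E_1[K]$ and $\check{\mathcal E}_1[\check K]$; these two commute; $C=q_1^{N/2}\check C$ is central; $KX_i^\pm(z)K^{-1}=q_2^{\pm\beta/2}X_i^\pm(z)$, $\check KX_i^\pm(z)\check K^{-1}=\check q_2^{\pm\check\beta/2}X_i^\pm(z)$. 2. Between $\mathcal E_1$ and $X_i^\pm$: $$e(u)X_i^+(z)-\omega^-(z/u)X_i^+(z)e(u)=\tfrac1{s_1^{-1}-s_1}\delta(z/u)X_{i-1}^+(q_1z),$$ $$[f(u),X_i^+(z)]=\tfrac1{s_1^{-1}-s_1}\delta\bigl(\tfrac{q_1^{-1}z}{Cu}\bigr)X_{i+1}^+(q_1^{-1}z)\psi^+(u),$$ $$\psi^\pm(u)X_i^+(z)\psi^\pm(u)^{-1}=\omega^\pm\bigl(\tfrac z{C^{(1\pm1)/2}u}\bigr)X_i^+(z),$$ $$[X_i^-(z),e(u)]=\tfrac1{s_1^{-1}-s_1}\delta\bigl(\tfrac{q_1^{-1}z}{Cu}\bigr)\psi^-(u)X_{i-1}^-(q_1^{-1}z),$$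 $$X_i^-(z)f(u)-\omega^+(z/u)f(u)X_i^-(z)=\tfrac1{s_1^{-1}-s_1}\delta(z/u)X_{i+1}^-(q_1z),$$ $$\psi^\pm(u)^{-1}X_i^-(z)\psi^\pm(u)=\omega^\pm\bigl(\tfrac z{C^{(1\mp1)/2}u}\bigr)X_i^-(z).$$ 3. Between $\check{\mathcal E}_1$ and $X_i^\pm$: $$\check e(u)X_i^+(z)-\check\omega^-(q_1^iz/u)X_i^+(z)\check e(u)=\tfrac1{\check s_1^{-1}-\check s_1}\delta(q_1^iz/u)X_{i-1}^+(z),$$ $$[\check f(u),X_i^+(z)]=\tfrac1{\check s_1^{-1}-\check s_1}\delta\bigl(\tfrac{q_1^{i+1}z}{\check Cu}\bigr)X_{i+1}^+(z)\check\psi^+(u),$$ $$\check\psi^\pm(u)X_i^+(z)\check\psi^\pm(u)^{-1}=\check\omega^\pm\bigl(\tfrac{q_1^iz}{\check C^{(1\pm1)/2}u}\bigr)X_i^+(z),$$ $$[X_i^-(z),\check e(u)]=\tfrac1{\check s_1^{-1}-\check s_1}\delta\bigl(\tfrac{q_1^{1-i}z}{\check Cu}\bigr)\check\psi^-(u)X_{i-1}^-(z),$$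 $$X_i^-(z)\check f(u)-\check\omega^+(q_1^{-i}z/u)\check f(u)X_i^-(z)=\tfrac1{\check s_1^{-1}-\check s_1}\delta(q_1^{-i}z/u)X_{i+1}^-(z),$$ $$\check\psi^\pm(u)^{-1}X_i^-(z)\check\psi^\pm(u)=\check\omega^\pm\bigl(\tfrac{q_1^{-i}z}{\check C^{(1\mp1)/2}u}\bigr)X_i^-(z).$$ 4. With $p_s(u)=\prod_{r=0}^s\frac{q_2^{-1}q_1^r-u}{q_1^r-u}$, and for $j=i+n$ with $n\ge1$: $$(z-q_2w)X_i^+(z)X_i^+(w)+(w-q_2z)X_i^+(w)X_i^+(z)=0,$$ $$(q_2z-w)X_i^-(z)X_i^-(w)+(q_2w-z)X_i^-(w)X_i^-(z)=0,$$ $$\prod_{r=1}^{n-1}(z-q_1^rw)X_i^+(z)X_j^+(w)+(-1)^nq_2\,p_n^+(z/w)\prod_{r=0}^{n-2}(q_3^{-1}q_1^rw-z)X_j^+(w)X_i^+(z)=0,$$ $$\prod_{r=1}^{n-1}(w-q_1^rz)X_i^-(z)X_j^-(w)+(-1)^nq_2\,p_n^-(w/z)\prod_{r=0}^{n-2}(q_3^{-1}q_1^rz-w)X_j^-(w)X_i^-(z)=0.$$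 5. With $r,\check r$ running over nonnegative integers, $$[X_i^+(z),X_j^-(w)]=\sum_{r+\check r=i+j+N/2}\delta\bigl(\tfrac{Cw}{q_1^rz}\bigr)k_r^+(q_1^{-r}w)\check k_{\check r}^+(\check q_1^{-\check r}q_1^{-j}w)-(-1)^N\!\!\sum_{r+\check r=-i-j+N/2}\delta\bigl(\tfrac{Cz}{q_1^rw}\bigr)k_r^-(q_1^{-r}z)\check k_{\check r}^-(\check q_1^{-\check r}q_1^iz).$$ The degree is given by $\deg e_k=\deg f_k=\deg X^\pm_{i,k}=k$, $\deg h_r=r$, similarly for checked generators, and $0$ on $C,K,\check C,\check K$; the weight is $\pm1$ on $X^\pm_{i,k}$ and $0$ on the other generators. These relations involve infinite sums. They are imposed on *admissible modules*: bigraded spaces $W=\bigoplus_{d_1,d_2\in\mathbb Z}W_{d_1,d_2}$ with finite-dimensional components and with $d_1$ bounded above for each $d_2$, on which a generator of degree $a$ and weight $b$ maps $W_{d_1,d_2}$ to $W_{d_1+a,d_2+b}$. Accordingly $\mathcal A_N$ (resp. $\mathcal A_N^-$) is the algebra generated by the generators in which two expressions are equal if and only if they act equally on every admissible module. **Theorem.**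 Let $N\in\mathbb Z$. (a) There is an algebra isomorphism $\mathcal A_N^-\to\mathcal A_N$, preserving degree and weight, with $$X_i^+(z)\mapsto X_{i+1/2}^+(z),\quad X_i^-(z)\mapsto X_{i-1/2}^-(z),\quad e(z)\mapsto e(z),\quad f(z)\mapsto f(z),\quad \check e(z)\mapsto\check e(s_1z),\quad \check f(z)\mapsto\check f(s_1z),$$ $\psi^\pm(z)\mapsto\psi^\pm(z)$, $\check\psi^\pm(z)\mapsto\check\psi^\pm(s_1z)$ (more precisely, $h_r\mapsto h_r$, $\check h_r\mapsto s_1^{-r}\check h_r$), and fixing $C,K,\check C,\check K$. (b) There is an algebra automorphism of $\mathcal A_N$, preserving degree and weight, with $$X_i^+(z)\mapsto X_{i+1}^+(z),\quad X_i^-(z)\mapsto X_{i-1}^-(z),\quad e(z)\mapsto e(z),\quad f(z)\mapsto f(z),\quad \check e(z)\mapsto\check e(q_1z),\quad \check f(z)\mapsto\check f(q_1z),$$ $\psi^\pm(z)\mapsto\psi^\pm(z)$, $\check\psi^\pm(z)\mapsto\check\psi^\pm(q_1z)$ (more precisely, $h_r\mapsto h_r$, $\check h_r\mapsto q_1^{-r}\check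 h_r$), and fixing $C,K,\check C,\check K$. (c) On every bigraded vector space, substitution (a) gives a bijection from the admissible $\mathcal A_N$-module structures to the admissible $\mathcal A_N^-$-module structures, and substitution (b) gives a bijection of the set of admissible $\mathcal A_N$-module structures with itself. -/

import Mathlib

noncomputable section

namespace ShiftedToroidal

/-! ### Locally finite sums of operators and formal series

A series `a(z) = ∑ a_n z^{-n}` with coefficients in a ring `A` is the function `n ↦ a_n`.
A series in two variables is the function `k l ↦` coefficient of (first variable)^{-k} times
(second variable)^{-l}. -/

section Series

variable {W : Type*} [AddCommGroup W] [Module ℂ W]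

open Classical in
/-- The sum `∑_{n ∈ ℤ} F n` of a locally finite family of operators: every vector is killed by all
but finitely many of them. (Value `0` if the family is not locally finite.) -/
def locSum (F : ℤ → Module.End ℂ W) : Module.End ℂ W :=
  if hF : ∀ v : W, (Function.support fun n => F n v).Finite then
    { toFun := fun v => ∑ᶠ n, F n v
      map_add' := fun v w => by
        simp only [map_add]
        exact finsum_add_distrib (hF v) (hF w)
      map_smul' := fun c v => by
        simp only [map_smul, RingHom.id_apply]
        exact (smul_finsum' c (hF v)).symm }
  else 0

/-- The series `a(cz)`. -/
def rescale (c : ℂ) (a : ℤ → Module.End ℂ W) : ℤ → Module.End ℂ W :=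
  fun n => c ^ (-n) • a n

/-- The product `a(z) b(z)` of two series in the same variable. -/
def mulSame (a b : ℤ → Module.End ℂ W) : ℤ → Module.End ℂ W :=
  fun n => locSum fun m => a (n - m) * b m

/-- The product `(α z₁ - β z₂) F(z₁,z₂)`. -/
def linMul (α β : Module.End ℂ W) (F : ℤ → ℤ → Module.End ℂ W) : ℤ → ℤ → Module.End ℂ W :=
  fun k l => α * F (k + 1) l - β * F k (l + 1)

/-- The product `∏_{r < n} (α_r z₁ - β_r z₂) · F(z₁,z₂)` with scalar coefficients. -/
def linProdMul (n : ℕ) (α β : ℕ → ℂ) (F : ℤ → ℤ → Module.End ℂ W) :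
    ℤ → ℤ → Module.End ℂ W :=
  (List.range n).foldr (fun r G => linMul (α r • 1) (β r • 1) G) F

/-- The product `(∑_n c_n (z₂/z₁)^n) F(z₁,z₂)`. -/
def ratioMul (c : ℤ → Module.End ℂ W) (F : ℤ → ℤ → Module.End ℂ W) :
    ℤ → ℤ → Module.End ℂ W :=
  fun k l => locSum fun n => c n * F (k - n) (l + n)

/-- For `α n = α ^ n`: the series `δ(α z₂/z₁) b(z₂)`, where `δ(x) = ∑_{n ∈ ℤ} x^n`. -/
def deltaSnd (α : ℤ → Module.End ℂ W) (b : ℤ → Module.End ℂ W) : ℤ → ℤ → Module.End ℂ W :=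
  fun k l => α k * b (k + l)

/-- For `α n = α ^ n`: the series `δ(α z₁/z₂) b(z₁)`, where `δ(x) = ∑_{n ∈ ℤ} x^n`. -/
def deltaFst (α : ℤ → Module.End ℂ W) (b : ℤ → Module.End ℂ W) : ℤ → ℤ → Module.End ℂ W :=
  fun k l => α l * b (k + l)

/-- The product `F(z₁,z₂) a(z₁)`. -/
def mulFstRight (F : ℤ → ℤ → Module.End ℂ W) (a : ℤ → Module.End ℂ W) :
    ℤ → ℤ → Module.End ℂ W :=
  fun k l => locSum fun p => F (k - p) l * a p

/-- The product `a(z₁) F(z₁,z₂)`. -/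
def mulFstLeft (a : ℤ → Module.End ℂ W) (F : ℤ → ℤ → Module.End ℂ W) :
    ℤ → ℤ → Module.End ℂ W :=
  fun k l => locSum fun p => a p * F (k - p) l

/-- For a series `F(z₁,z₂)` that is a Laurent polynomial on every vector: the series
`z^{-d} F(z, αz)`. -/
def evalDiag (α : ℂ) (d : ℤ) (F : ℤ → ℤ → Module.End ℂ W) : ℤ → Module.End ℂ W :=
  fun n => locSum fun l => α ^ (-l) • F (n - d - l) l

/-- The coefficient of `x^n` in `exp (∑_{r ≥ 1} a_r x^r)`. -/
def expCoeff (a : ℕ → Module.End ℂ W) (n : ℕ) : Module.End ℂ W :=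
  ∑ m ∈ Finset.range (n + 1), ((m.factorial : ℂ)⁻¹) •
    PowerSeries.coeff n ((PowerSeries.mk fun r => if r = 0 then 0 else a r) ^ m)

end Series

/-- The coefficients of the expansion of `P/Q` at `0` in powers of `x` (for `Q(0) ≠ 0`). -/
def expandZero (P Q : Polynomial ℂ) (n : ℤ) : ℂ :=
  if 0 ≤ n then PowerSeries.coeff n.toNat ((P : PowerSeries ℂ) * (Q : PowerSeries ℂ)⁻¹) else 0

/-- The coefficients of the expansion of `P/Q` at `∞` in powers of `x⁻¹`
(for `deg P ≤ deg Q`, `Q ≠ 0`); the value at `n` is the coefficient of `x^n`. -/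
def expandInfty (P Q : Polynomial ℂ) (n : ℤ) : ℂ :=
  if n ≤ 0 then PowerSeries.coeff (-n).toNat
    (((Polynomial.reflect Q.natDegree P : Polynomial ℂ) : PowerSeries ℂ) *
      ((Polynomial.reflect Q.natDegree Q : Polynomial ℂ) : PowerSeries ℂ)⁻¹)
  else 0

/-! ### Parameters -/

/-- Logarithms of `q₁` and `q₂`; the logarithm of `q₃` is `-(log q₁ + log q₂)`. -/
structure Logs where
  l₁ : ℂ
  l₂ : ℂ

namespace Logs

variable (L : Logs)

def q₁ : ℂ := Complex.exp L.l₁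
def q₂ : ℂ := Complex.exp L.l₂
def q₃ : ℂ := Complex.exp (-(L.l₁ + L.l₂))

/-- `s₁ = q₁^{1/2}` -/
def s₁ : ℂ := Complex.exp (L.l₁ / 2)

/-- `κ_r = (1 - q₁^r)(1 - q₂^r)(1 - q₃^r)` -/
def κ (r : ℤ) : ℂ := (1 - L.q₁ ^ r) * (1 - L.q₂ ^ r) * (1 - L.q₃ ^ r)

/-- `c₁ = κ₁ / (s₁ - s₁⁻¹)` -/
def c₁ : ℂ := L.κ 1 / (L.s₁ - L.s₁⁻¹)

/-- The checked parameters `q̌₁ = q₁⁻¹`, `q̌₂ = q₂`, `q̌₃ = q₁² q₃`. -/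
def check : Logs := ⟨-L.l₁, L.l₂⟩

/-- Numerator of `ω(x) = (1 - q₂x)(1 - q₃x) / ((1 - x)(1 - q₂q₃x))`. -/
def omegaNum : Polynomial ℂ :=
  (1 - Polynomial.C L.q₂ * Polynomial.X) * (1 - Polynomial.C L.q₃ * Polynomial.X)

/-- Denominator of `ω(x)`. -/
def omegaDen : Polynomial ℂ :=
  (1 - Polynomial.X) * (1 - Polynomial.C (L.q₂ * L.q₃) * Polynomial.X)

/-- `ω⁺`, the expansion of `ω` at `0`. -/
def omegaPlus : ℤ → ℂ := expandZero L.omegaNum L.omegaDen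

/-- `ω⁻`, the expansion of `ω` at `∞`. -/
def omegaMinus : ℤ → ℂ := expandInfty L.omegaNum L.omegaDen

/-- Numerator of `p_s(u) = ∏_{r=0}^{s} (q₂⁻¹ q₁^r - u) / (q₁^r - u)`. -/
def pNum (s : ℕ) : Polynomial ℂ :=
  ∏ r ∈ Finset.range (s + 1), (Polynomial.C (L.q₂⁻¹ * L.q₁ ^ r) - Polynomial.X)

/-- Denominator of `p_s(u)`. -/
def pDen (s : ℕ) : Polynomial ℂ :=
  ∏ r ∈ Finset.range (s + 1), (Polynomial.C (L.q₁ ^ r) - Polynomial.X)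

end Logs

/-- The parameters of the algebras: `q₁, q₂, q₃` with `q₁q₂q₃ = 1` and `q₁, q₂` generic, with a choice
of logarithms, and a number `β` with `q₃ = q₁^{-β}`. -/
structure Params extends Logs where
  β : ℂ
  generic : ∀ a b : ℤ, toLogs.q₁ ^ a * toLogs.q₂ ^ b = 1 → a = 0 ∧ b = 0
  q₃_eq : toLogs.q₃ = Complex.exp (-β * l₁)

/-! ### Quantum toroidal `gl₁` -/

/-- Generators of `E₁[K]`, where `ψ₀ = 1`. -/
inductive TorGen
  | e (k : ℤ)
  | f (k : ℤ)
  | h (r : {r : ℤ // r ≠ 0})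
  | C
  | Cinv
  | K
  | Kinv

section Toroidal

variable {W : Type*} [AddCommGroup W] [Module ℂ W] (L : Logs) (y : TorGen → Module.End ℂ W)

/-- `C^n`, `n ∈ ℤ`. -/
def Cpow (n : ℤ) : Module.End ℂ W :=
  if 0 ≤ n then y .C ^ n.toNat else y .Cinv ^ (-n).toNat

/-- `h_r`, with `h_0 := 0`. -/
def hMode (r : ℤ) : Module.End ℂ W := if hr : r ≠ 0 then y (.h ⟨r, hr⟩) else 0

/-- `ψ⁺(z) = exp (∑_{r>0} κ_r h_r z^{-r})` -/
def psiPlus : ℤ → Module.End ℂ W := fun n =>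
  if 0 ≤ n then expCoeff (fun r => L.κ r • hMode y r) n.toNat else 0

/-- `ψ⁻(z) = exp (∑_{r>0} κ_r h_{-r} z^{r})` -/
def psiMinus : ℤ → Module.End ℂ W := fun n =>
  if n ≤ 0 then expCoeff (fun r => L.κ r • hMode y (-r)) (-n).toNat else 0

/-- The product `g(D z₁, z₂) F(z₁,z₂)`, where `g(z,w) = (z - q₁w)(z - q₂w)(z - q₃w)`. -/
def gMul (D : Module.End ℂ W) (F : ℤ → ℤ → Module.End ℂ W) : ℤ → ℤ → Module.End ℂ W :=
  linMul D (L.q₁ • 1) (linMul D (L.q₂ • 1) (linMul D (L.q₃ • 1) F))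

/-- The product `g(z₂, D z₁) F(z₁,z₂)`, where `g(z,w) = (z - q₁w)(z - q₂w)(z - q₃w)`. -/
def gMul' (D : Module.End ℂ W) (F : ℤ → ℤ → Module.End ℂ W) : ℤ → ℤ → Module.End ℂ W :=
  linMul (-(L.q₁ • D)) (-1) (linMul (-(L.q₂ • D)) (-1) (linMul (-(L.q₃ • D)) (-1) F))

/-- The operators `y` satisfy the relations of `E₁(q₁,q₂,q₃)[K]` with `ψ₀ = 1`, where `K` and `C`
are invertible and central. -/
structure IsToroidal : Prop where
  C_mul_Cinv : y .C * y .Cinv = 1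
  Cinv_mul_C : y .Cinv * y .C = 1
  K_mul_Kinv : y .K * y .Kinv = 1
  Kinv_mul_K : y .Kinv * y .K = 1
  C_central : ∀ g, Commute (y .C) (y g)
  K_central : ∀ g, Commute (y .K) (y g)
  /-- `[h_r, h_s] = δ_{r+s,0} r⁻¹ (C^r - C^{-r}) / κ_r` -/
  hh : ∀ r s : ℤ, r ≠ 0 → s ≠ 0 → hMode y r * hMode y s - hMode y s * hMode y r =
    if r + s = 0 then ((r : ℂ) * L.κ r)⁻¹ • (Cpow y r - Cpow y (-r)) else 0
  /-- `g(Cz,w) ψ⁺(z) e(w) + g(w,Cz) e(w) ψ⁺(z) = 0` -/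
  psiPlus_e : ∀ k l,
    gMul L (y .C) (fun k l => psiPlus L y k * y (.e l)) k l +
      gMul' L (y .C) (fun k l => y (.e l) * psiPlus L y k) k l = 0
  /-- `g(z,w) ψ⁻(z) e(w) + g(w,z) e(w) ψ⁻(z) = 0` -/
  psiMinus_e : ∀ k l,
    gMul L 1 (fun k l => psiMinus L y k * y (.e l)) k l +
      gMul' L 1 (fun k l => y (.e l) * psiMinus L y k) k l = 0
  /-- `g(w,z) ψ⁺(z) f(w) + g(z,w) f(w) ψ⁺(z) = 0` -/
  psiPlus_f : ∀ k l,
    gMul' L 1 (fun k l => psiPlus L y k * y (.f l)) k l +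
      gMul L 1 (fun k l => y (.f l) * psiPlus L y k) k l = 0
  /-- `g(w,Cz) ψ⁻(z) f(w) + g(Cz,w) f(w) ψ⁻(z) = 0` -/
  psiMinus_f : ∀ k l,
    gMul' L (y .C) (fun k l => psiMinus L y k * y (.f l)) k l +
      gMul L (y .C) (fun k l => y (.f l) * psiMinus L y k) k l = 0
  /-- `[e(z), f(w)] = κ₁⁻¹ (δ(Cw/z) ψ⁺(w) - δ(Cz/w) ψ⁻(z))` -/
  ef : ∀ k l, y (.e k) * y (.f l) - y (.f l) * y (.e k) =
    (L.κ 1)⁻¹ • (deltaSnd (Cpow y) (psiPlus L y) k l - deltaFst (Cpow y) (psiMinus L y) k l)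
  /-- `g(z,w) e(z) e(w) + g(w,z) e(w) e(z) = 0` -/
  ee : ∀ k l,
    gMul L 1 (fun k l => y (.e k) * y (.e l)) k l +
      gMul' L 1 (fun k l => y (.e l) * y (.e k)) k l = 0
  /-- `g(w,z) f(z) f(w) + g(z,w) f(w) f(z) = 0` -/
  ff : ∀ k l,
    gMul' L 1 (fun k l => y (.f k) * y (.f l)) k l +
      gMul L 1 (fun k l => y (.f l) * y (.f k)) k l = 0
  /-- `Sym z₁ z₂² [e(z₁), [e(z₂), e(z₃)]] = 0` -/
  serre_e : ∀ n : Fin 3 → ℤ, ∑ σ : Equiv.Perm (Fin 3),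
    ⁅y (.e (n (σ 0) + 1)), ⁅y (.e (n (σ 1) + 2)), y (.e (n (σ 2)))⁆⁆ = 0
  /-- `Sym z₁ z₂² [f(z₁), [f(z₂), f(z₃)]] = 0` -/
  serre_f : ∀ n : Fin 3 → ℤ, ∑ σ : Equiv.Perm (Fin 3),
    ⁅y (.f (n (σ 0) + 1)), ⁅y (.f (n (σ 1) + 2)), y (.f (n (σ 2)))⁆⁆ = 0

/-- The product `∏_{j<r} g(q₁^j z₁, z₂) · F(z₁,z₂)`, which clears the poles of
`e^{(r)}(z₁) e(z₂)` and of `f(z₂) f^{(r)}(z₁)`. -/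
def fuseMul (r : ℕ) (F : ℤ → ℤ → Module.End ℂ W) : ℤ → ℤ → Module.End ℂ W :=
  (List.range r).foldr (fun j G => gMul L ((L.q₁ ^ j) • 1) G) F

/-- The number `∏_{j<r} g(q₁^j, q₁^r)`. -/
def fuseConst (r : ℕ) : ℂ :=
  ∏ j ∈ Finset.range r, (L.q₁ ^ j - L.q₁ * L.q₁ ^ r) * (L.q₁ ^ j - L.q₂ * L.q₁ ^ r) *
    (L.q₁ ^ j - L.q₃ * L.q₁ ^ r)

/-- The fused current `e^{(r)}(z) = c₁^r e(z) e(q₁z) ⋯ e(q₁^{r-1}z)`. Each factor `e(q₁^r z)` is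
multiplied on the right by evaluating the Laurent polynomial
`∏_{j<r} g(q₁^j z, w) · e^{(r)}(z) e(w)` at `w = q₁^r z` and dividing by
`∏_{j<r} g(q₁^j z, q₁^r z)`, a nonzero multiple of `z^{3r}`. -/
def eFused : ℕ → ℤ → Module.End ℂ W
  | 0 => fun n => if n = 0 then 1 else 0
  | r + 1 => fun n => (L.c₁ * (fuseConst L r)⁻¹) •
      evalDiag (L.q₁ ^ r) (3 * r) (fuseMul L r fun k l => eFused r k * y (.e l)) n

/-- The fused current `f^{(r)}(z) = (-c₁)^r f(q₁^{r-1}z) ⋯ f(q₁z) f(z)`, defined as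
`eFused` with the factors multiplied on the left. -/
def fFused : ℕ → ℤ → Module.End ℂ W
  | 0 => fun n => if n = 0 then 1 else 0
  | r + 1 => fun n => (-L.c₁ * (fuseConst L r)⁻¹) •
      evalDiag (L.q₁ ^ r) (3 * r) (fuseMul L r fun k l => y (.f l) * fFused r k) n

/-- `k₀⁺(z) = K exp (∑_{r>0} κ_r / (q₁^{-r} - 1) h_r z^{-r})` -/
def kZeroPlus : ℤ → Module.End ℂ W := fun n =>
  if 0 ≤ n then
    y .K * expCoeff (fun r => (L.κ r / (L.q₁ ^ (-(r : ℤ)) - 1)) • hMode y r) n.toNat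
  else 0

/-- `k₀⁻(z) = K⁻¹ exp (∑_{r>0} κ_r / (q₁^{r} - 1) h_{-r} z^{r})` -/
def kZeroMinus : ℤ → Module.End ℂ W := fun n =>
  if n ≤ 0 then
    y .Kinv * expCoeff (fun r => (L.κ r / (L.q₁ ^ (r : ℤ) - 1)) • hMode y (-r)) (-n).toNat
  else 0

/-- `k_r⁺(z) = f^{(r)}(z) k₀⁺(z)` -/
def kPlus (r : ℕ) : ℤ → Module.End ℂ W := mulSame (fFused L y r) (kZeroPlus L y)

/-- `k_r⁻(z) = k₀⁻(z) e^{(r)}(z)` -/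
def kMinus (r : ℕ) : ℤ → Module.End ℂ W := mulSame (kZeroMinus L y) (eFused L y r)

/-- The relations of a current `X⁺(z)` with `e(u), f(u), ψ^±(u)`:
* `e(u) X(z) - ω⁻(γz/u) X(z) e(u) = (s₁⁻¹ - s₁)⁻¹ δ(γz/u) X'(z)`,
* `[f(u), X(z)] = (s₁⁻¹ - s₁)⁻¹ δ(γq₁⁻¹z/(Cu)) X''(z) ψ⁺(u)`,
* `ψ⁺(u) X(z) ψ⁺(u)⁻¹ = ω⁺(γz/(Cu)) X(z)`, `ψ⁻(u) X(z) ψ⁻(u)⁻¹ = ω⁻(γz/u) X(z)`,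

the last two being multiplied by `ψ^±(u)` from the right. -/
structure PlusRelations (γ : ℂ) (X X' X'' : ℤ → Module.End ℂ W) : Prop where
  e_rel : ∀ k l, y (.e k) * X l -
      ratioMul (fun n => (L.omegaMinus n * γ ^ n) • 1) (fun k l => X l * y (.e k)) k l =
    (L.s₁⁻¹ - L.s₁)⁻¹ • deltaSnd (fun n => (γ ^ n) • 1) X' k l
  f_rel : ∀ k l, y (.f k) * X l - X l * y (.f k) =
    (L.s₁⁻¹ - L.s₁)⁻¹ • mulFstRight
      (deltaSnd (fun n => ((γ * L.q₁⁻¹) ^ n) • Cpow y (-n)) X'') (psiPlus L y) k l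
  psiPlus_rel : ∀ k l, psiPlus L y k * X l =
    ratioMul (fun n => (L.omegaPlus n * γ ^ n) • Cpow y (-n))
      (fun k l => X l * psiPlus L y k) k l
  psiMinus_rel : ∀ k l, psiMinus L y k * X l =
    ratioMul (fun n => (L.omegaMinus n * γ ^ n) • 1) (fun k l => X l * psiMinus L y k) k l

/-- The relations of a current `X⁻(z)` with `e(u), f(u), ψ^±(u)`:
* `[X(z), e(u)] = (s₁⁻¹ - s₁)⁻¹ δ(γq₁⁻¹z/(Cu)) ψ⁻(u) X'(z)`,
* `X(z) f(u) - ω⁺(γz/u) f(u) X(z) = (s₁⁻¹ - s₁)⁻¹ δ(γz/u) X''(z)`,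
* `ψ⁺(u)⁻¹ X(z) ψ⁺(u) = ω⁺(γz/u) X(z)`, `ψ⁻(u)⁻¹ X(z) ψ⁻(u) = ω⁻(γz/(Cu)) X(z)`,

the last two being multiplied by `ψ^±(u)` from the left. -/
structure MinusRelations (γ : ℂ) (X X' X'' : ℤ → Module.End ℂ W) : Prop where
  e_rel : ∀ k l, X l * y (.e k) - y (.e k) * X l =
    (L.s₁⁻¹ - L.s₁)⁻¹ • mulFstLeft (psiMinus L y)
      (deltaSnd (fun n => ((γ * L.q₁⁻¹) ^ n) • Cpow y (-n)) X') k l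
  f_rel : ∀ k l, X l * y (.f k) -
      ratioMul (fun n => (L.omegaPlus n * γ ^ n) • 1) (fun k l => y (.f k) * X l) k l =
    (L.s₁⁻¹ - L.s₁)⁻¹ • deltaSnd (fun n => (γ ^ n) • 1) X'' k l
  psiPlus_rel : ∀ k l, X l * psiPlus L y k =
    ratioMul (fun n => (L.omegaPlus n * γ ^ n) • 1) (fun k l => psiPlus L y k * X l) k l
  psiMinus_rel : ∀ k l, X l * psiMinus L y k =
    ratioMul (fun n => (L.omegaMinus n * γ ^ n) • Cpow y (-n))
      (fun k l => psiMinus L y k * X l) k l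

end Toroidal

/-! ### The algebras `A_N` and `A_N⁻` -/

/-- The set of labels `i ∈ ½ℤ` such that `2i ≡ ε mod 2`; the label `i` is stored as the integer
`2i`. Thus `Label 0` is the set of integer labels and `Label 1` is `½ + ℤ`. -/
def Label (ε : ZMod 2) : Type := {a : ℤ // (a : ZMod 2) = ε}

/-- The label `i + n`, where `n` is an integer. -/
def Label.add {ε : ZMod 2} (a : Label ε) (n : ℤ) : Label ε :=
  ⟨a.1 + 2 * n, by
    have h2 : (2 : ZMod 2) = 0 := rfl
    rw [Int.cast_add, Int.cast_mul, Int.cast_ofNat, h2, zero_mul, add_zero, a.2]⟩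

/-- The generators: those of `E₁[K]`, those of `Ě₁[Ǩ]`, and `X^±_{i,k}`. The labels `i` of `X⁻` satisfy
`2i ≡ ε`, those of `X⁺` satisfy `2i ≡ N + ε` mod 2. For `ε = 0` these are the generators of `A_N`, for
`ε = 1` the generators of `A_N⁻`. -/
inductive Gen (N : ℤ) (ε : ZMod 2)
  | E (g : TorGen)
  | Echeck (g : TorGen)
  | Xp (i : Label (N + ε)) (k : ℤ)
  | Xm (i : Label ε) (k : ℤ)

/-- The degree of generators of `E₁[K]`. -/
def TorGen.deg : TorGen → ℤ
  | .e k => k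
  | .f k => k
  | .h r => r.1
  | _ => 0

/-- The degree: `deg e_k = deg f_k = k`, `deg h_r = r`, `deg X^±_{i,k} = k`. -/
def Gen.deg {N : ℤ} {ε : ZMod 2} : Gen N ε → ℤ
  | .E g => g.deg
  | .Echeck g => g.deg
  | .Xp _ k => k
  | .Xm _ k => k

/-- The weight: `wt X^±_{i,k} = ±1`, and `0` for the other generators. -/
def Gen.wt {N : ℤ} {ε : ZMod 2} : Gen N ε → ℤ
  | .Xp _ _ => 1
  | .Xm _ _ => -1
  | _ => 0

/-- The finite set of pairs `(r, ř)` of nonnegative integers with `2(r + ř) = m`. -/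
def pairs (m : ℤ) : Finset (ℕ × ℕ) :=
  (Finset.range (m.toNat + 1) ×ˢ Finset.range (m.toNat + 1)).filter
    fun p => 2 * ((p.1 : ℤ) + (p.2 : ℤ)) = m

section Algebra

variable (P : Params) (N : ℤ) (ε : ZMod 2)

/-- The operators `x` satisfy the defining relations of `A_N` (for `ε = 0`), respectively of `A_N⁻`
(for `ε = 1`). With the label `i` stored as `2i`, the number `q₁^i` is `s₁^{2i}`. -/
structure SatisfiesRelations {W : Type*} [AddCommGroup W] [Module ℂ W]
    (x : Gen N ε → Module.End ℂ W) : Prop where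
  toroidal : IsToroidal P.toLogs fun g => x (.E g)
  toroidal_check : IsToroidal P.check fun g => x (.Echeck g)
  commute : ∀ g g', Commute (x (.E g)) (x (.Echeck g'))
  /-- `C = q₁^{N/2} Č` -/
  C_eq : x (.E .C) = P.s₁ ^ N • x (.Echeck .C)
  C_central : ∀ g, Commute (x (.E .C)) (x g)
  K_Xp : ∀ i k, x (.E .K) * x (.Xp i k) * x (.E .Kinv) =
    Complex.exp (P.β / 2 * P.l₂) • x (.Xp i k)
  K_Xm : ∀ i k, x (.E .K) * x (.Xm i k) * x (.E .Kinv) =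
    Complex.exp (-(P.β / 2 * P.l₂)) • x (.Xm i k)
  /-- `q̌₂ = q₂` and `β̌ = 2 - β` -/
  Kcheck_Xp : ∀ i k, x (.Echeck .K) * x (.Xp i k) * x (.Echeck .Kinv) =
    Complex.exp ((2 - P.β) / 2 * P.l₂) • x (.Xp i k)
  Kcheck_Xm : ∀ i k, x (.Echeck .K) * x (.Xm i k) * x (.Echeck .Kinv) =
    Complex.exp (-((2 - P.β) / 2 * P.l₂)) • x (.Xm i k)
  /-- `E₁` and `X_i⁺(z)`, with `X_{i-1}⁺(q₁z)` and `X_{i+1}⁺(q₁⁻¹z)` on the right hand sides -/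
  E_Xp : ∀ i, PlusRelations P.toLogs (fun g => x (.E g)) 1 (fun k => x (.Xp i k))
    (rescale P.q₁ fun k => x (.Xp (i.add (-1)) k))
    (rescale P.q₁⁻¹ fun k => x (.Xp (i.add 1) k))
  /-- `Ě₁` and `X_i⁺(z)`, with `X_{i-1}⁺(z)` and `X_{i+1}⁺(z)` on the right hand sides -/
  Echeck_Xp : ∀ i, PlusRelations P.check (fun g => x (.Echeck g)) (P.s₁ ^ i.1)
    (fun k => x (.Xp i k)) (fun k => x (.Xp (i.add (-1)) k)) (fun k => x (.Xp (i.add 1) k))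
  /-- `E₁` and `X_i⁻(z)`, with `X_{i-1}⁻(q₁⁻¹z)` and `X_{i+1}⁻(q₁z)` on the right hand sides -/
  E_Xm : ∀ i, MinusRelations P.toLogs (fun g => x (.E g)) 1 (fun k => x (.Xm i k))
    (rescale P.q₁⁻¹ fun k => x (.Xm (i.add (-1)) k))
    (rescale P.q₁ fun k => x (.Xm (i.add 1) k))
  /-- `Ě₁` and `X_i⁻(z)`, with `X_{i-1}⁻(z)` and `X_{i+1}⁻(z)` on the right hand sides -/
  Echeck_Xm : ∀ i, MinusRelations P.check (fun g => x (.Echeck g)) (P.s₁ ^ (-i.1))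
    (fun k => x (.Xm i k)) (fun k => x (.Xm (i.add (-1)) k)) (fun k => x (.Xm (i.add 1) k))
  /-- `(z - q₂w) X_i⁺(z) X_i⁺(w) + (w - q₂z) X_i⁺(w) X_i⁺(z) = 0` -/
  Xp_Xp_same : ∀ i k l,
    linMul 1 (P.q₂ • 1) (fun k l => x (.Xp i k) * x (.Xp i l)) k l +
      linMul (-(P.q₂ • 1)) (-1) (fun k l => x (.Xp i l) * x (.Xp i k)) k l = 0
  /-- `(q₂z - w) X_i⁻(z) X_i⁻(w) + (q₂w - z) X_i⁻(w) X_i⁻(z) = 0` -/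
  Xm_Xm_same : ∀ i k l,
    linMul (P.q₂ • 1) 1 (fun k l => x (.Xm i k) * x (.Xm i l)) k l +
      linMul (-1) (-(P.q₂ • 1)) (fun k l => x (.Xm i l) * x (.Xm i k)) k l = 0
  /-- For `j = i + n`, `n ≥ 1`: `∏_{r=1}^{n-1} (z - q₁^r w) X_i⁺(z) X_j⁺(w) +
  (-1)^n q₂ p_n⁺(z/w) ∏_{r=0}^{n-2} (q₃⁻¹ q₁^r w - z) X_j⁺(w) X_i⁺(z) = 0` -/
  Xp_Xp : ∀ i (n : ℕ), 1 ≤ n → ∀ k l,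
    linProdMul (n - 1) (fun _ => 1) (fun r => P.q₁ ^ (r + 1))
        (fun k l => x (.Xp i k) * x (.Xp (i.add n) l)) k l +
      ((-1) ^ n * P.q₂) • ratioMul (fun m => expandZero (P.pNum n) (P.pDen n) (-m) • 1)
        (linProdMul (n - 1) (fun _ => -1) (fun r => -(P.q₃⁻¹ * P.q₁ ^ r))
          fun k l => x (.Xp (i.add n) l) * x (.Xp i k)) k l = 0
  /-- For `j = i + n`, `n ≥ 1`: `∏_{r=1}^{n-1} (w - q₁^r z) X_i⁻(z) X_j⁻(w) +
  (-1)^n q₂ p_n⁻(w/z) ∏_{r=0}^{n-2} (q₃⁻¹ q₁^r z - w) X_j⁻(w) X_i⁻(z) = 0` -/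
  Xm_Xm : ∀ i (n : ℕ), 1 ≤ n → ∀ k l,
    linProdMul (n - 1) (fun r => -P.q₁ ^ (r + 1)) (fun _ => -1)
        (fun k l => x (.Xm i k) * x (.Xm (i.add n) l)) k l +
      ((-1) ^ n * P.q₂) • ratioMul (fun m => expandInfty (P.pNum n) (P.pDen n) m • 1)
        (linProdMul (n - 1) (fun r => P.q₃⁻¹ * P.q₁ ^ r) (fun _ => 1)
          fun k l => x (.Xm (i.add n) l) * x (.Xm i k)) k l = 0
  /-- `[X_i⁺(z), X_j⁻(w)] =
  ∑_{r+ř=i+j+N/2} δ(Cw/(q₁^r z)) k_r⁺(q₁^{-r}w) ǩ_ř⁺(q̌₁^{-ř} q₁^{-j} w)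
  - (-1)^N ∑_{r+ř=-i-j+N/2} δ(Cz/(q₁^r w)) k_r⁻(q₁^{-r}z) ǩ_ř⁻(q̌₁^{-ř} q₁^i z)` -/
  Xp_Xm : ∀ (i : Label (N + ε)) (j : Label ε) (k l : ℤ),
    x (.Xp i k) * x (.Xm j l) - x (.Xm j l) * x (.Xp i k) =
      ∑ p ∈ pairs (i.1 + j.1 + N),
        deltaSnd (fun n => ((P.q₁ ^ p.1)⁻¹ ^ n) • Cpow (fun g => x (.E g)) n)
          (mulSame
            (rescale (P.q₁ ^ p.1)⁻¹ (kPlus P.toLogs (fun g => x (.E g)) p.1))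
            (rescale ((P.check.q₁ ^ p.2)⁻¹ * P.s₁ ^ (-j.1))
              (kPlus P.check (fun g => x (.Echeck g)) p.2))) k l -
      ((-1 : ℂ) ^ N) • ∑ p ∈ pairs (-i.1 - j.1 + N),
        deltaFst (fun n => ((P.q₁ ^ p.1)⁻¹ ^ n) • Cpow (fun g => x (.E g)) n)
          (mulSame
            (rescale (P.q₁ ^ p.1)⁻¹ (kMinus P.toLogs (fun g => x (.E g)) p.1))
            (rescale ((P.check.q₁ ^ p.2)⁻¹ * P.s₁ ^ i.1)
              (kMinus P.check (fun g => x (.Echeck g)) p.2))) k l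

/-- An admissible module over `A_N` (for `ε = 0`), `A_N⁻` (for `ε = 1`) with the underlying space
`W = ⊕ W_{d₁,d₂}`: the homogeneous components are finite-dimensional, for every weight `d₂` the
degrees `d₁` are bounded from above, and the generators act by homogeneous operators that satisfy
the relations. -/
structure IsAdmissibleModule {W : Type*} [AddCommGroup W] [Module ℂ W]
    (𝒲 : ℤ × ℤ → Submodule ℂ W) (x : Gen N ε → Module.End ℂ W) : Prop where
  internal : DirectSum.IsInternal 𝒲
  finite_dim : ∀ d, FiniteDimensional ℂ (𝒲 d)
  bounded : ∀ d₂ : ℤ, ∃ d : ℤ, ∀ d₁ > d, 𝒲 (d₁, d₂) = ⊥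
  graded : ∀ g d₁ d₂, ∀ v ∈ 𝒲 (d₁, d₂), x g v ∈ 𝒲 (d₁ + g.deg, d₂ + g.wt)
  relations : SatisfiesRelations P N ε x

/-- Two elements of the free algebra are identified if they act by the same operator on every
admissible module. (Admissible modules have countable dimension, so it suffices to use spaces in
`Type`.) -/
def sameAction : RingCon (FreeAlgebra ℂ (Gen N ε)) where
  r a b := ∀ (W : Type) [AddCommGroup W] [Module ℂ W] (𝒲 : ℤ × ℤ → Submodule ℂ W)
    (x : Gen N ε → Module.End ℂ W), IsAdmissibleModule P N ε 𝒲 x →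
      FreeAlgebra.lift ℂ x a = FreeAlgebra.lift ℂ x b
  iseqv :=
    { refl := fun _ _ _ _ _ _ _ => rfl
      symm := fun h W _ _ 𝒲 x hx => (h W 𝒲 x hx).symm
      trans := fun h h' W _ _ 𝒲 x hx => (h W 𝒲 x hx).trans (h' W 𝒲 x hx) }
  mul' := fun h h' W _ _ 𝒲 x hx => by rw [map_mul, map_mul, h W 𝒲 x hx, h' W 𝒲 x hx]
  add' := fun h h' W _ _ 𝒲 x hx => by rw [map_add, map_add, h W 𝒲 x hx, h' W 𝒲 x hx]

/-- The algebra `A_N` (for `ε = 0`), `A_N⁻` (for `ε = 1`): the unital associative algebra generated by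
the generators, two expressions being equal if and only if they are equal as operators on every
admissible module. -/
abbrev ShiftedAlgebra : Type := (sameAction P N ε).Quotient

/-- The algebra `A_N`. -/
abbrev AlgA : Type := ShiftedAlgebra P N 0

/-- The algebra `A_N⁻`. -/
abbrev AlgAminus : Type := ShiftedAlgebra P N 1

/-- The generators as elements of the algebra. -/
def gen (g : Gen N ε) : ShiftedAlgebra P N ε :=
  (sameAction P N ε).mkₐ (α := ℂ) (FreeAlgebra.ι ℂ g)

/-- The subspace of elements of degree `d` and weight `w`. -/
def homogeneous (d w : ℤ) : Submodule ℂ (ShiftedAlgebra P N ε) :=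
  Submodule.span ℂ {a | ∃ u : List (Gen N ε), (u.map Gen.deg).sum = d ∧
    (u.map Gen.wt).sum = w ∧ a = (u.map (gen P N ε)).prod}

/-- The elements `x g` are the images of the generators under the substitution
`X_i^±(z) ↦ X_{i ± m/2}^±(z)`, `e(z) ↦ e(z)`, `f(z) ↦ f(z)`, `ψ^±(z) ↦ ψ^±(z)`, `C ↦ C`, `K ↦ K`,
`ě(z) ↦ ě(s₁^m z)`, `f̌(z) ↦ f̌(s₁^m z)`, `ψ̌^±(z) ↦ ψ̌^±(s₁^m z)`, `Č ↦ Č`, `Ǩ ↦ Ǩ`,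
where the series on the right are formed by the elements `y g`. -/
structure IsShift {N : ℤ} {ε ε' : ZMod 2} {A : Type*} [Ring A] [Algebra ℂ A] (m : ℤ)
    (x : Gen N ε → A) (y : Gen N ε' → A) : Prop where
  E : ∀ g, x (.E g) = y (.E g)
  Echeck : ∀ g, x (.Echeck g) = (P.s₁ ^ m) ^ (-g.deg) • y (.Echeck g)
  Xp : ∀ (i : Label (N + ε)) (i' : Label (N + ε')), i'.1 = i.1 + m →
    ∀ k, x (.Xp i k) = y (.Xp i' k)
  Xm : ∀ (i : Label ε) (i' : Label ε'), i'.1 = i.1 - m → ∀ k, x (.Xm i k) = y (.Xm i' k)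

end Algebra

end ShiftedToroidal

end

open ShiftedToroidal

noncomputable section

namespace ShiftedToroidal

/-! ### Rescaling the variables of formal series -/

section Series

variable {W : Type*} [AddCommGroup W] [Module ℂ W]

/-! Both substitutions are instances, `m = 1` and `m = 2`, of one shift by `m/2`, up on the labels
of `X⁺` and down on those of `X⁻`, defined whenever `ε' = ε + m` mod 2. In the relations a label
occurs in three ways only: through differences of labels of the same sign, through the sum `i + j`
in the commutator of `X_i⁺` with `X_j⁻`, and through the factors `q₁^i`, `q₁^(-j)` in arguments
involving checked currents. The shift preserves the differences and the sum, and multiplies both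
factors by `s₁^m`. This is compensated by replacing `u` by `s₁^m u` in all checked currents, which
is harmless since the toroidal relations are homogeneous (`IsToroidal.rescale`,
`PlusRelations.rescale`, `MinusRelations.rescale`, `kPlus_rescale`, `kMinus_rescale`).

Thus an admissible module for `ε'` becomes, on the same bigraded space, one for `ε`
(`SatisfiesRelations.shift`), and the shift by `-m` inverts this. Equality in the algebras is tested
on admissible modules, so pulling modules back shows that the substitution on free algebras respects
the congruence (`shiftHom`); the opposite shift provides the inverse. Degrees and weights are
untouched. -/

/-- For `c ≠ 0` the supports of the two families agree, so both are locally finite or both sums take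
the default value `0`; for `c = 0` both sides vanish. No local finiteness is assumed, so the
rescaling identities below need no convergence argument. -/
theorem locSum_smul (c : ℂ) (F : ℤ → Module.End ℂ W) :
    locSum (fun n => c • F n) = c • locSum F := by
  rcases eq_or_ne c 0 with rfl | hc
  · ext v
    simp [locSum]
  · have hs : ∀ v : W, (Function.support fun n => (c • F n) v) =
        Function.support fun n => F n v := by
      intro v
      ext n
      simp [hc]
    by_cases hF : ∀ v : W, (Function.support fun n => F n v).Finite
    · have hF' : ∀ v : W, (Function.support fun n => (c • F n) v).Finite := fun v => by
        rw [hs v]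
        exact hF v
      ext v
      rw [locSum, dif_pos hF', locSum, dif_pos hF]
      exact (smul_finsum' c (hF v)).symm
    · have hF' : ¬ ∀ v : W, (Function.support fun n => (c • F n) v).Finite := fun h =>
        hF fun v => by
          rw [← hs v]
          exact h v
      rw [locSum, dif_neg hF', locSum, dif_neg hF, smul_zero]

theorem locSum_congr_smul {c : ℂ} {F G : ℤ → Module.End ℂ W} (h : ∀ n, F n = c • G n) :
    locSum F = c • locSum G := by
  rw [← locSum_smul, funext h]

theorem rescale_rescale (c t : ℂ) (a : ℤ → Module.End ℂ W) :
    rescale c (rescale t a) = rescale (c * t) a := by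
  funext n
  simp only [rescale, smul_smul, mul_zpow]

theorem mulSame_rescale {t : ℂ} (ht : t ≠ 0) (a b : ℤ → Module.End ℂ W) :
    mulSame (rescale t a) (rescale t b) = rescale t (mulSame a b) := by
  funext n
  refine locSum_congr_smul fun m => ?_
  rw [rescale, rescale, smul_mul_smul_comm, ← zpow_add₀ ht]
  congr 2
  ring

/-- `F'(z₁,z₂) = t^d F(tz₁,tz₂)` -/
def IsRescaled (t : ℂ) (d : ℤ) (F' F : ℤ → ℤ → Module.End ℂ W) : Prop :=
  ∀ k l, F' k l = t ^ (d - k - l) • F k l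

variable {t : ℂ} {d : ℤ} {F' F : ℤ → ℤ → Module.End ℂ W}

theorem IsRescaled.mul {a' b' a b : ℤ → Module.End ℂ W} (ht : t ≠ 0)
    (ha : ∀ k, a' k = t ^ (-k) • a k) (hb : ∀ k, b' k = t ^ (-k) • b k) :
    IsRescaled t 0 (fun k l => a' k * b' l) (fun k l => a k * b l) := fun k l => by
  simp only [ha, hb]
  rw [smul_mul_smul_comm, ← zpow_add₀ ht]
  congr 2
  ring

theorem IsRescaled.mul' {a' b' a b : ℤ → Module.End ℂ W} (ht : t ≠ 0)
    (ha : ∀ k, a' k = t ^ (-k) • a k) (hb : ∀ k, b' k = t ^ (-k) • b k) :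
    IsRescaled t 0 (fun k l => b' l * a' k) (fun k l => b l * a k) := fun k l => by
  simp only [ha, hb]
  rw [smul_mul_smul_comm, ← zpow_add₀ ht]
  congr 2
  ring

/-- A linear form in `z₁, z₂` is `t⁻¹` times the same form in `tz₁, tz₂`, which lowers the exponent
by one; each cubic factor `g` therefore lowers it by three. -/
theorem IsRescaled.linMul (h : IsRescaled t d F' F) (α β : Module.End ℂ W) :
    IsRescaled t (d - 1) (linMul α β F') (linMul α β F) := fun k l => by
  simp only [ShiftedToroidal.linMul]
  rw [h, h, mul_smul_comm, mul_smul_comm, smul_sub,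
    show d - (k + 1) - l = d - 1 - k - l by ring, show d - k - (l + 1) = d - 1 - k - l by ring]

theorem IsRescaled.gMul (h : IsRescaled t d F' F) (L : Logs) (D : Module.End ℂ W) :
    IsRescaled t (d - 3) (gMul L D F') (gMul L D F) := by
  have h3 := ((h.linMul D (L.q₃ • 1)).linMul D (L.q₂ • 1)).linMul D (L.q₁ • 1)
  rwa [show d - 1 - 1 - 1 = d - 3 by ring] at h3

theorem IsRescaled.gMul' (h : IsRescaled t d F' F) (L : Logs) (D : Module.End ℂ W) :
    IsRescaled t (d - 3) (gMul' L D F') (gMul' L D F) := by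
  have h3 := ((h.linMul (-(L.q₃ • D)) (-1)).linMul (-(L.q₂ • D)) (-1)).linMul
    (-(L.q₁ • D)) (-1)
  rwa [show d - 1 - 1 - 1 = d - 3 by ring] at h3

theorem IsRescaled.add_eq_zero {G' G : ℤ → ℤ → Module.End ℂ W} (h : IsRescaled t d F' F)
    (h' : IsRescaled t d G' G) {k l : ℤ} (h0 : F k l + G k l = 0) : F' k l + G' k l = 0 := by
  rw [h, h', ← smul_add, h0, smul_zero]

theorem IsRescaled.fuseMul (h : IsRescaled t d F' F) (L : Logs) (r : ℕ) :
    IsRescaled t (d - 3 * r) (fuseMul L r F') (fuseMul L r F) := by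
  unfold ShiftedToroidal.fuseMul
  -- An arbitrary list is used because `foldr` peels off the head, whereas passing from `List.range
  -- r` to `List.range (r + 1)` adds an element at the end.
  have key : ∀ js : List ℕ, IsRescaled t (d - 3 * js.length)
      (js.foldr (fun j G => ShiftedToroidal.gMul L ((L.q₁ ^ j) • 1) G) F')
      (js.foldr (fun j G => ShiftedToroidal.gMul L ((L.q₁ ^ j) • 1) G) F) := by
    intro js
    induction js with
    | nil => simpa using h
    | cons j js ih =>
      have := ih.gMul L ((L.q₁ ^ j) • 1)
      simp only [List.foldr_cons, List.length_cons]
      convert this using 1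
      push_cast
      ring
  simpa using key (List.range r)

/-- The normalising factor `z^(-d)` absorbs `t^(-d)`, and the line `z₂ = αz₁` is stable under
simultaneous scaling of the two variables. -/
theorem IsRescaled.evalDiag (h : IsRescaled t (-d) F' F) (α : ℂ) :
    evalDiag α d F' = rescale t (evalDiag α d F) := by
  funext n
  refine locSum_congr_smul fun l => ?_
  rw [h, smul_comm]
  congr 2
  ring

theorem expCoeff_rescale (c : ℂ) {a' a : ℕ → Module.End ℂ W} (h : ∀ r, a' r = c ^ r • a r)
    (n : ℕ) : expCoeff a' n = c ^ n • expCoeff a n := by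
  have key : ∀ m n, PowerSeries.coeff n ((PowerSeries.mk fun r => if r = 0 then 0 else a' r) ^ m) =
      c ^ n • PowerSeries.coeff n ((PowerSeries.mk fun r => if r = 0 then 0 else a r) ^ m) := by
    intro m
    induction m with
    | zero =>
      intro n
      rcases eq_or_ne n 0 with rfl | hn
      · simp
      · simp [PowerSeries.coeff_one, hn]
    | succ m ih =>
      intro n
      rw [pow_succ, pow_succ, PowerSeries.coeff_mul, PowerSeries.coeff_mul, Finset.smul_sum]
      refine Finset.sum_congr rfl fun p hp => ?_
      rw [Finset.HasAntidiagonal.mem_antidiagonal] at hp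
      rw [ih, PowerSeries.coeff_mk, PowerSeries.coeff_mk]
      split_ifs
      · simp
      · rw [h, smul_mul_smul_comm, ← pow_add, hp]
  simp only [expCoeff, key, Finset.smul_sum]
  exact Finset.sum_congr rfl fun m _ => smul_comm _ _ _

theorem smul_lie_smul (c c' : ℂ) (a b : Module.End ℂ W) :
    ⁅c • a, c' • b⁆ = (c * c') • ⁅a, b⁆ := by
  rw [Ring.lie_def, Ring.lie_def, smul_mul_smul_comm, smul_mul_smul_comm, mul_comm c', smul_sub]

end Series

/-! ### Rescaling the currents of quantum toroidal `gl₁` -/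

/-- The operators `t^{-deg g} y_g`: the currents are replaced by `e(tz)`, `f(tz)`, `ψ^±(tz)`. -/
def TorGen.rescale {A : Type*} [Ring A] [Algebra ℂ A] (t : ℂ) (y : TorGen → A) : TorGen → A :=
  fun g => t ^ (-g.deg) • y g

section Toroidal

variable {W : Type*} [AddCommGroup W] [Module ℂ W] (L : Logs) {t : ℂ} (ht : t ≠ 0)
  (y : TorGen → Module.End ℂ W)

theorem rescale_e (k : ℤ) : TorGen.rescale t y (.e k) = t ^ (-k) • y (.e k) := rfl

theorem rescale_f (k : ℤ) : TorGen.rescale t y (.f k) = t ^ (-k) • y (.f k) := rfl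

theorem rescale_C : TorGen.rescale t y .C = y .C := by simp [TorGen.rescale, TorGen.deg]

theorem rescale_Cinv : TorGen.rescale t y .Cinv = y .Cinv := by
  simp [TorGen.rescale, TorGen.deg]

theorem rescale_K : TorGen.rescale t y .K = y .K := by simp [TorGen.rescale, TorGen.deg]

theorem rescale_Kinv : TorGen.rescale t y .Kinv = y .Kinv := by
  simp [TorGen.rescale, TorGen.deg]

theorem Cpow_rescale : Cpow (TorGen.rescale t y) = Cpow y := by
  funext n
  simp only [Cpow, rescale_C, rescale_Cinv]

theorem hMode_rescale (r : ℤ) : hMode (TorGen.rescale t y) r = t ^ (-r) • hMode y r := by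
  unfold hMode
  split_ifs
  · rfl
  · rw [smul_zero]

/-- The coefficients `c` are arbitrary so that the statement covers both `ψ⁺` and `k₀⁺`; its
companion for negative modes covers `ψ⁻` and `k₀⁻`. -/
theorem expCoeff_hMode_rescale (c : ℕ → ℂ) (n : ℕ) :
    expCoeff (fun r => c r • hMode (TorGen.rescale t y) r) n =
      t ^ (-(n : ℤ)) • expCoeff (fun r => c r • hMode y r) n := by
  rw [expCoeff_rescale t⁻¹ (a := fun r => c r • hMode y r)]
  · simp
  · intro r
    rw [hMode_rescale, smul_comm]
    simp

theorem expCoeff_hMode_neg_rescale (c : ℕ → ℂ) (n : ℕ) :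
    expCoeff (fun r => c r • hMode (TorGen.rescale t y) (-r)) n =
      t ^ (n : ℤ) • expCoeff (fun r => c r • hMode y (-r)) n := by
  rw [expCoeff_rescale t (a := fun r => c r • hMode y (-r))]
  · simp
  · intro r
    rw [hMode_rescale, smul_comm]
    simp

theorem psiPlus_rescale : psiPlus L (TorGen.rescale t y) = rescale t (psiPlus L y) := by
  funext n
  simp only [psiPlus, rescale]
  split_ifs with hn
  · rw [expCoeff_hMode_rescale y (fun r => L.κ r), Int.toNat_of_nonneg hn]
  · rw [smul_zero]

theorem psiMinus_rescale : psiMinus L (TorGen.rescale t y) = rescale t (psiMinus L y) := by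
  funext n
  simp only [psiMinus, rescale]
  split_ifs with hn
  · rw [expCoeff_hMode_neg_rescale y (fun r => L.κ r), Int.toNat_of_nonneg (by lia)]
  · rw [smul_zero]

theorem kZeroPlus_rescale : kZeroPlus L (TorGen.rescale t y) = rescale t (kZeroPlus L y) := by
  funext n
  simp only [kZeroPlus, rescale, rescale_K]
  split_ifs with hn
  · rw [expCoeff_hMode_rescale y (fun r => L.κ r / (L.q₁ ^ (-(r : ℤ)) - 1)),
      Int.toNat_of_nonneg hn, mul_smul_comm]
  · rw [smul_zero]

theorem kZeroMinus_rescale : kZeroMinus L (TorGen.rescale t y) = rescale t (kZeroMinus L y) := by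
  funext n
  simp only [kZeroMinus, rescale, rescale_Kinv]
  split_ifs with hn
  · rw [expCoeff_hMode_neg_rescale y (fun r => L.κ r / (L.q₁ ^ (r : ℤ) - 1)),
      Int.toNat_of_nonneg (by lia), mul_smul_comm]
  · rw [smul_zero]

include ht

/-- The `r` cubic factors clearing the poles contribute `t^(-3r)`, exactly what the division by
`z^(3r)` in `evalDiag` compensates. So fusion commutes with rescaling, and `fuseConst` is not
affected. -/
theorem eFused_rescale (r : ℕ) :
    eFused L (TorGen.rescale t y) r = rescale t (eFused L y r) := by
  induction r with
  | zero =>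
    funext n
    simp only [eFused, rescale]
    split_ifs with hn
    · simp [hn]
    · simp
  | succ r ih =>
    funext n
    have h := IsRescaled.mul ht (fun k => congrFun ih k) (rescale_e y (t := t))
    have h' := h.fuseMul L r
    rw [zero_sub] at h'
    simp only [eFused, h'.evalDiag, rescale]
    rw [smul_comm]

theorem fFused_rescale (r : ℕ) :
    fFused L (TorGen.rescale t y) r = rescale t (fFused L y r) := by
  induction r with
  | zero =>
    funext n
    simp only [fFused, rescale]
    split_ifs with hn
    · simp [hn]
    · simp
  | succ r ih =>
    funext n
    have h := IsRescaled.mul' ht (fun k => congrFun ih k) (rescale_f y (t := t))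
    have h' := h.fuseMul L r
    rw [zero_sub] at h'
    simp only [fFused, h'.evalDiag, rescale]
    rw [smul_comm]

theorem kPlus_rescale (r : ℕ) : kPlus L (TorGen.rescale t y) r = rescale t (kPlus L y r) := by
  rw [kPlus, fFused_rescale L ht, kZeroPlus_rescale, mulSame_rescale ht, kPlus]

theorem kMinus_rescale (r : ℕ) : kMinus L (TorGen.rescale t y) r = rescale t (kMinus L y r) := by
  rw [kMinus, eFused_rescale L ht, kZeroMinus_rescale, mulSame_rescale ht, kMinus]

/-! ### Invariance of the toroidal relations and of the relations with `X^±` under rescaling. -/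

variable {L y}

theorem IsToroidal.rescale (hy : IsToroidal L y) : IsToroidal L (TorGen.rescale t y) where
  C_mul_Cinv := by rw [rescale_C, rescale_Cinv, hy.C_mul_Cinv]
  Cinv_mul_C := by rw [rescale_C, rescale_Cinv, hy.Cinv_mul_C]
  K_mul_Kinv := by rw [rescale_K, rescale_Kinv, hy.K_mul_Kinv]
  Kinv_mul_K := by rw [rescale_K, rescale_Kinv, hy.Kinv_mul_K]
  C_central g := by
    rw [rescale_C]
    exact (hy.C_central g).smul_right _
  K_central g := by
    rw [rescale_K]
    exact (hy.K_central g).smul_right _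
  hh r s hr hs := by
    rw [hMode_rescale, hMode_rescale, smul_mul_smul_comm, smul_mul_smul_comm,
      mul_comm (t ^ (-s)), ← smul_sub, hy.hh r s hr hs, Cpow_rescale, ← zpow_add₀ ht]
    split_ifs with h
    -- The bracket is nonzero only in total degree `r + s = 0`, where the scaling factor is `1`.
    · rw [show -r + -s = 0 by lia, zpow_zero, one_smul]
    · rw [smul_zero]
  psiPlus_e k l := by
    rw [rescale_C]
    have h := congrFun (psiPlus_rescale L y (t := t))
    exact ((IsRescaled.mul ht h (rescale_e y)).gMul L _).add_eq_zero
      ((IsRescaled.mul' ht h (rescale_e y)).gMul' L _) (hy.psiPlus_e k l)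
  psiMinus_e k l := by
    have h := congrFun (psiMinus_rescale L y (t := t))
    exact ((IsRescaled.mul ht h (rescale_e y)).gMul L _).add_eq_zero
      ((IsRescaled.mul' ht h (rescale_e y)).gMul' L _) (hy.psiMinus_e k l)
  psiPlus_f k l := by
    have h := congrFun (psiPlus_rescale L y (t := t))
    exact ((IsRescaled.mul ht h (rescale_f y)).gMul' L _).add_eq_zero
      ((IsRescaled.mul' ht h (rescale_f y)).gMul L _) (hy.psiPlus_f k l)
  psiMinus_f k l := by
    rw [rescale_C]
    have h := congrFun (psiMinus_rescale L y (t := t))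
    exact ((IsRescaled.mul ht h (rescale_f y)).gMul' L _).add_eq_zero
      ((IsRescaled.mul' ht h (rescale_f y)).gMul L _) (hy.psiMinus_f k l)
  ef k l := by
    rw [rescale_e, rescale_f, smul_mul_smul_comm, smul_mul_smul_comm, mul_comm (t ^ (-l)),
      ← smul_sub, hy.ef, Cpow_rescale, psiPlus_rescale, psiMinus_rescale, smul_comm]
    -- Delta functions depend only on the ratio of the variables, so both terms acquire just the
    -- factor `t^(-(k+l))` from `ψ^±`.
    simp only [deltaSnd, deltaFst, ShiftedToroidal.rescale, mul_smul_comm]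
    rw [← smul_sub, ← zpow_add₀ ht, neg_add]
  ee k l := ((IsRescaled.mul ht (rescale_e y) (rescale_e y)).gMul L _).add_eq_zero
    ((IsRescaled.mul' ht (rescale_e y) (rescale_e y)).gMul' L _) (hy.ee k l)
  ff k l := ((IsRescaled.mul ht (rescale_f y) (rescale_f y)).gMul' L _).add_eq_zero
    ((IsRescaled.mul' ht (rescale_f y) (rescale_f y)).gMul L _) (hy.ff k l)
  serre_e n := by
    -- The `3` is the degree of the monomial `z₁ z₂²`. All summands carry the same power of `t`,
    -- since a permutation does not change `n 0 + n 1 + n 2`.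
    have h := congrArg (t ^ (-(n 0 + n 1 + n 2) - 3) • ·) (hy.serre_e n)
    simp only [smul_zero, Finset.smul_sum] at h
    rw [← h]
    refine Finset.sum_congr rfl fun σ _ => ?_
    have hσ := Equiv.sum_comp σ n
    simp only [Fin.sum_univ_three] at hσ
    simp only [rescale_e, smul_lie_smul, ← zpow_add₀ ht]
    congr 2
    lia
  serre_f n := by
    have h := congrArg (t ^ (-(n 0 + n 1 + n 2) - 3) • ·) (hy.serre_f n)
    simp only [smul_zero, Finset.smul_sum] at h
    rw [← h]
    refine Finset.sum_congr rfl fun σ _ => ?_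
    have hσ := Equiv.sum_comp σ n
    simp only [Fin.sum_univ_three] at hσ
    simp only [rescale_f, smul_lie_smul, ← zpow_add₀ ht]
    congr 2
    lia

/-- The variables of the toroidal current and of `X` meet only in the ratio `γz/u`. Replacing `u` by
`tu` while leaving the `X` currents alone amounts to replacing `γ` by `γ/t`. -/
theorem PlusRelations.rescale {γ γ' : ℂ} (hγ : γ = γ' * t) {X X' X'' : ℤ → Module.End ℂ W}
    (h : PlusRelations L y γ X X' X'') :
    PlusRelations L (TorGen.rescale t y) γ' X X' X'' where
  e_rel k l := by
    -- In the `n`-th term the toroidal mode has index `k - n`, and `t^(-(k-n)) γ'^n = t^(-k) γ^n`.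
    have h1 : ratioMul (fun n => (L.omegaMinus n * γ' ^ n) • (1 : Module.End ℂ W))
        (fun k l => X l * TorGen.rescale t y (.e k)) k l = t ^ (-k) •
        ratioMul (fun n => (L.omegaMinus n * γ ^ n) • 1) (fun k l => X l * y (.e k)) k l :=
      locSum_congr_smul fun n => by
        simp only [rescale_e, hγ, mul_zpow, smul_mul_assoc, mul_smul_comm, smul_smul]
        congr 1
        rw [neg_sub, sub_eq_add_neg, zpow_add₀ ht]
        ring
    rw [h1, rescale_e, smul_mul_assoc, ← smul_sub, h.e_rel, smul_comm]
    simp only [deltaSnd, hγ, mul_zpow, smul_mul_assoc, smul_smul]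
    congr 2
    rw [zpow_neg]
    field_simp
  f_rel k l := by
    -- Here `ψ⁺` has index `n` and the delta function index `k - n`; together they give `t^(-n)
    -- t^(-(k-n)) = t^(-k)`.
    have h1 : mulFstRight (deltaSnd (fun n => ((γ' * L.q₁⁻¹) ^ n) •
          Cpow (TorGen.rescale t y) (-n)) X'') (psiPlus L (TorGen.rescale t y)) k l = t ^ (-k) •
        mulFstRight (deltaSnd (fun n => ((γ * L.q₁⁻¹) ^ n) • Cpow y (-n)) X'')
          (psiPlus L y) k l :=
      locSum_congr_smul fun n => by
        simp only [psiPlus_rescale, Cpow_rescale, deltaSnd, ShiftedToroidal.rescale, hγ,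
          mul_zpow, smul_mul_assoc, mul_smul_comm, smul_smul]
        congr 1
        rw [show -k = -(k - n) + -n by ring, zpow_add₀ ht, zpow_neg t (k - n)]
        field_simp
    rw [h1, rescale_f, smul_mul_assoc, mul_smul_comm, ← smul_sub, h.f_rel, smul_comm]
  psiPlus_rel k l := by
    rw [psiPlus_rescale, ShiftedToroidal.rescale, smul_mul_assoc, h.psiPlus_rel, eq_comm]
    refine locSum_congr_smul fun n => ?_
    simp only [ShiftedToroidal.rescale, Cpow_rescale, hγ, mul_zpow, smul_mul_assoc, mul_smul_comm,
      smul_smul]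
    congr 1
    rw [neg_sub, sub_eq_add_neg, zpow_add₀ ht]
    ring
  psiMinus_rel k l := by
    rw [psiMinus_rescale, ShiftedToroidal.rescale, smul_mul_assoc, h.psiMinus_rel, eq_comm]
    refine locSum_congr_smul fun n => ?_
    simp only [ShiftedToroidal.rescale, hγ, mul_zpow, smul_mul_assoc, mul_smul_comm,
      smul_smul]
    congr 1
    rw [neg_sub, sub_eq_add_neg, zpow_add₀ ht]
    ring

theorem MinusRelations.rescale {γ γ' : ℂ} (hγ : γ = γ' * t) {X X' X'' : ℤ → Module.End ℂ W}
    (h : MinusRelations L y γ X X' X'') :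
    MinusRelations L (TorGen.rescale t y) γ' X X' X'' where
  e_rel k l := by
    have h1 : mulFstLeft (psiMinus L (TorGen.rescale t y)) (deltaSnd (fun n =>
          ((γ' * L.q₁⁻¹) ^ n) • Cpow (TorGen.rescale t y) (-n)) X') k l = t ^ (-k) •
        mulFstLeft (psiMinus L y)
          (deltaSnd (fun n => ((γ * L.q₁⁻¹) ^ n) • Cpow y (-n)) X') k l :=
      locSum_congr_smul fun n => by
        simp only [psiMinus_rescale, Cpow_rescale, deltaSnd, ShiftedToroidal.rescale, hγ,
          mul_zpow, smul_mul_assoc, mul_smul_comm, smul_smul]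
        congr 1
        rw [show -k = -(k - n) + -n by ring, zpow_add₀ ht, zpow_neg t (k - n)]
        field_simp
    rw [h1, rescale_e, smul_mul_assoc, mul_smul_comm, ← smul_sub, h.e_rel, smul_comm]
  f_rel k l := by
    have h1 : ratioMul (fun n => (L.omegaPlus n * γ' ^ n) • (1 : Module.End ℂ W))
        (fun k l => TorGen.rescale t y (.f k) * X l) k l = t ^ (-k) •
        ratioMul (fun n => (L.omegaPlus n * γ ^ n) • 1) (fun k l => y (.f k) * X l) k l :=
      locSum_congr_smul fun n => by
        simp only [rescale_f, hγ, mul_zpow, smul_mul_assoc, mul_smul_comm, smul_smul]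
        congr 1
        rw [neg_sub, sub_eq_add_neg, zpow_add₀ ht]
        ring
    rw [h1, rescale_f, mul_smul_comm, ← smul_sub, h.f_rel, smul_comm]
    simp only [deltaSnd, hγ, mul_zpow, smul_mul_assoc, smul_smul]
    congr 2
    rw [zpow_neg]
    field_simp
  psiPlus_rel k l := by
    rw [psiPlus_rescale, ShiftedToroidal.rescale, mul_smul_comm, h.psiPlus_rel, eq_comm]
    refine locSum_congr_smul fun n => ?_
    simp only [ShiftedToroidal.rescale, hγ, mul_zpow, smul_mul_assoc, mul_smul_comm,
      smul_smul]
    congr 1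
    rw [neg_sub, sub_eq_add_neg, zpow_add₀ ht]
    ring
  psiMinus_rel k l := by
    rw [psiMinus_rescale, ShiftedToroidal.rescale, mul_smul_comm, h.psiMinus_rel, eq_comm]
    refine locSum_congr_smul fun n => ?_
    simp only [ShiftedToroidal.rescale, Cpow_rescale, hγ, mul_zpow, smul_mul_assoc, mul_smul_comm,
      smul_smul]
    congr 1
    rw [neg_sub, sub_eq_add_neg, zpow_add₀ ht]
    ring

end Toroidal

/-! ### Shifting the labels -/

theorem Logs.s₁_ne_zero (L : Logs) : L.s₁ ≠ 0 := Complex.exp_ne_zero _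

theorem Label.ext {ε : ZMod 2} {a b : Label ε} (h : a.1 = b.1) : a = b := Subtype.ext h

/-- The label `i + m/2`. -/
def Label.shift {ε ε' : ZMod 2} (m : ℤ) (hm : ε' = ε + m) (a : Label ε) : Label ε' :=
  ⟨a.1 + m, by rw [Int.cast_add, a.2, hm]⟩

/-- This carries the neighbouring labels `i ± 1`, and `j = i + n` in the quadratic relations, to the
corresponding neighbours of the shifted label. -/
theorem Label.shift_add {ε ε' : ZMod 2} (m : ℤ) (hm : ε' = ε + m) (a : Label ε) (n : ℤ) :
    (a.add n).shift m hm = (a.shift m hm).add n :=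
  Label.ext (by simp only [Label.shift, Label.add]; ring)

section Parity

variable {N m : ℤ} {ε ε' : ZMod 2}

theorem parity_plus (hm : ε' = ε + m) : (N : ZMod 2) + ε' = N + ε + m := by
  rw [hm, add_assoc]

/-- Signs are invisible mod 2, so labels of `X⁻` can move down by `m/2` into the same parity class
that an upward shift would reach. -/
theorem parity_minus (hm : ε' = ε + m) : ε' = ε + (-m : ℤ) := by
  rw [hm, Int.cast_neg, ZMod.neg_eq_self_mod_two]

theorem parity_symm (hm : ε' = ε + m) : ε = ε' + (-m : ℤ) := by
  rw [hm, Int.cast_neg, add_neg_cancel_right]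

/-- The generator with shifted label to which the substitution sends a given generator, up to a
scalar factor. -/
def Gen.shift (hm : ε' = ε + m) : Gen N ε → Gen N ε'
  | .E g => .E g
  | .Echeck g => .Echeck g
  | .Xp i k => .Xp (i.shift m (parity_plus hm)) k
  | .Xm i k => .Xm (i.shift (-m) (parity_minus hm)) k

theorem Gen.deg_shift (hm : ε' = ε + m) (g : Gen N ε) : (g.shift hm).deg = g.deg := by
  cases g <;> rfl

theorem Gen.wt_shift (hm : ε' = ε + m) (g : Gen N ε) : (g.shift hm).wt = g.wt := by
  cases g <;> rfl

theorem Gen.shift_shift (hm : ε' = ε + m) (g : Gen N ε) :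
    (g.shift hm).shift (parity_symm hm) = g := by
  cases g with
  | E g => rfl
  | Echeck g => rfl
  | Xp i k => exact congrArg (Gen.Xp · k) (Label.ext (by simp [Label.shift]))
  | Xm i k => exact congrArg (Gen.Xm · k) (Label.ext (by simp [Label.shift]))

variable (P : Params)

/-- The scalar factor by which the substitution multiplies a generator. -/
def shiftScalar (m : ℤ) : Gen N ε → ℂ
  | .Echeck g => (P.s₁ ^ m) ^ (-g.deg)
  | _ => 1

theorem shiftScalar_mul_shift (hm : ε' = ε + m) (g : Gen N ε) :
    shiftScalar P (-m) (g.shift hm) * shiftScalar P m g = 1 := by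
  cases g with
  | Echeck g =>
    simp only [Gen.shift, shiftScalar]
    rw [← mul_zpow, ← zpow_add₀ P.s₁_ne_zero, neg_add_cancel, zpow_zero, one_zpow]
  | _ => exact mul_one 1

variable {A : Type*} [Ring A] [Algebra ℂ A]

/-- The images of the generators under the substitution, formed by the elements `y g`. -/
def shiftFamily (hm : ε' = ε + m) (y : Gen N ε' → A) : Gen N ε → A :=
  fun g => shiftScalar P m g • y (g.shift hm)

/-- A separate `m'` with an equation lets both orders of composition be covered: one of them needs
`m = -(-m)`. -/
theorem shiftFamily_shiftFamily {m' : ℤ} (hm : ε' = ε + m) (hm' : ε = ε' + m') (h : m' = -m)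
    (y : Gen N ε → A) : shiftFamily P hm (shiftFamily P hm' y) = y := by
  subst h
  funext g
  simp only [shiftFamily, smul_smul]
  rw [mul_comm, shiftScalar_mul_shift, one_smul, Gen.shift_shift]

theorem isShift_shiftFamily (hm : ε' = ε + m) (y : Gen N ε' → A) :
    IsShift P m (shiftFamily P hm y) y where
  E _ := one_smul _ _
  Echeck _ := rfl
  Xp i i' h k := by
    rw [show i' = i.shift m (parity_plus hm) from Label.ext h]
    exact one_smul _ _
  Xm i i' h k := by
    rw [show i' = i.shift (-m) (parity_minus hm) from Label.ext h]
    exact one_smul _ _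

end Parity

/-! ### The relations are preserved -/

section Modules

variable {P : Params} {N m : ℤ} {ε ε' : ZMod 2} {W : Type*} [AddCommGroup W] [Module ℂ W]

theorem SatisfiesRelations.shift (hm : ε' = ε + m) {y : Gen N ε' → Module.End ℂ W}
    (hy : SatisfiesRelations P N ε' y) : SatisfiesRelations P N ε (shiftFamily P hm y) := by
  have hs := P.s₁_ne_zero
  have ht : P.s₁ ^ m ≠ 0 := zpow_ne_zero m hs
  set x := shiftFamily P hm y
  have hE : ∀ g, x (.E g) = y (.E g) := fun g => one_smul _ _
  have hEc : ∀ g, x (.Echeck g) =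
      TorGen.rescale (P.s₁ ^ m) (fun g => y (.Echeck g)) g := fun g => rfl
  have hEc0 : ∀ g, g.deg = 0 → x (.Echeck g) = y (.Echeck g) := fun g h => by
    rw [hEc, TorGen.rescale, h, neg_zero, zpow_zero, one_smul]
  have hXp : ∀ i k, x (.Xp i k) = y (.Xp (i.shift m (parity_plus hm)) k) :=
    fun i k => one_smul _ _
  have hXm : ∀ i k, x (.Xm i k) = y (.Xm (i.shift (-m) (parity_minus hm)) k) :=
    fun i k => one_smul _ _
  exact
  { toroidal := by
      simp only [hE]
      exact hy.toroidal
    toroidal_check := hy.toroidal_check.rescale ht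
    commute := fun g g' => by
      rw [hE]
      exact (hy.commute g g').smul_right _
    C_eq := by rw [hE, hEc0 _ rfl, hy.C_eq]
    C_central := fun g => by
      rw [hE]
      exact (hy.C_central _).smul_right _
    K_Xp := fun i k => by rw [hE, hE, hXp, hy.K_Xp]
    K_Xm := fun i k => by rw [hE, hE, hXm, hy.K_Xm]
    Kcheck_Xp := fun i k => by rw [hEc0 _ rfl, hEc0 _ rfl, hXp, hy.Kcheck_Xp]
    Kcheck_Xm := fun i k => by rw [hEc0 _ rfl, hEc0 _ rfl, hXm, hy.Kcheck_Xm]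
    E_Xp := fun i => by
      simp only [hE, hXp, Label.shift_add]
      exact hy.E_Xp _
    Echeck_Xp := fun i => by
      simp only [hXp, Label.shift_add]
      -- The shifted label has `γ = s₁^(i+m)` in doubled notation; rescaling the checked currents by
      -- `s₁^m` brings it back to `s₁^i`.
      exact (hy.Echeck_Xp (i.shift m (parity_plus hm))).rescale ht (zpow_add₀ hs _ _)
    E_Xm := fun i => by
      simp only [hE, hXm, Label.shift_add]
      exact hy.E_Xm _
    Echeck_Xm := fun i => by
      simp only [hXm, Label.shift_add]
      refine (hy.Echeck_Xm _).rescale ht ?_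
      rw [← zpow_add₀ hs]
      congr 1
      simp only [Label.shift]
      ring
    Xp_Xp_same := fun i k l => by
      simp only [hXp]
      exact hy.Xp_Xp_same _ k l
    Xm_Xm_same := fun i k l => by
      simp only [hXm]
      exact hy.Xm_Xm_same _ k l
    Xp_Xp := fun i n hn k l => by
      simp only [hXp, Label.shift_add]
      exact hy.Xp_Xp _ n hn k l
    Xm_Xm := fun i n hn k l => by
      simp only [hXm, Label.shift_add]
      exact hy.Xm_Xm _ n hn k l
    Xp_Xm := fun i j k l => by
      -- The opposite shifts cancel in `i + j`, so both sums run over the same `pairs`.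
      have h1 : (i.shift m (parity_plus (N := N) hm)).1 +
          (j.shift (-m) (parity_minus hm)).1 + N = i.1 + j.1 + N := by
        simp only [Label.shift]
        ring
      have h2 : -(i.shift m (parity_plus (N := N) hm)).1 -
          (j.shift (-m) (parity_minus hm)).1 + N = -i.1 - j.1 + N := by
        simp only [Label.shift]
        ring
      -- The powers from `-j` and from `i` gain the same factor `s₁^m`, so a single rescaling of the
      -- checked currents accounts for both `ǩ⁺` and `ǩ⁻`.
      have hp : P.s₁ ^ (-(j.shift (-m) (parity_minus hm)).1) =
          P.s₁ ^ (-j.1) * P.s₁ ^ m := by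
        rw [← zpow_add₀ hs]
        congr 1
        simp only [Label.shift]
        ring
      have hq : P.s₁ ^ (i.shift m (parity_plus (N := N) hm)).1 = P.s₁ ^ i.1 * P.s₁ ^ m :=
        zpow_add₀ hs _ _
      have h := hy.Xp_Xm (i.shift m (parity_plus hm)) (j.shift (-m) (parity_minus hm)) k l
      rw [h1, h2, hp, hq] at h
      simp only [hE, hXp, hXm, h, hEc, kPlus_rescale _ ht, kMinus_rescale _ ht,
        rescale_rescale, mul_assoc] }

theorem IsAdmissibleModule.shift (hm : ε' = ε + m) {𝒲 : ℤ × ℤ → Submodule ℂ W}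
    {y : Gen N ε' → Module.End ℂ W} (hy : IsAdmissibleModule P N ε' 𝒲 y) :
    IsAdmissibleModule P N ε 𝒲 (shiftFamily P hm y) where
  internal := hy.internal
  finite_dim := hy.finite_dim
  bounded := hy.bounded
  graded g d₁ d₂ v hv := by
    have h := hy.graded (g.shift hm) d₁ d₂ v hv
    rw [Gen.deg_shift, Gen.wt_shift] at h
    exact Submodule.smul_mem _ _ h
  relations := hy.relations.shift hm

/-- The substitution as a bijection between the admissible module structures on a bigraded space. -/
def admissibleEquiv (P : Params) (N : ℤ) (hm : ε' = ε + m) (𝒲 : ℤ × ℤ → Submodule ℂ W) :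
    {y : Gen N ε' → Module.End ℂ W // IsAdmissibleModule P N ε' 𝒲 y} ≃
      {x : Gen N ε → Module.End ℂ W // IsAdmissibleModule P N ε 𝒲 x} where
  toFun y := ⟨shiftFamily P hm y.1, y.2.shift hm⟩
  invFun x := ⟨shiftFamily P (parity_symm hm) x.1, x.2.shift (parity_symm hm)⟩
  left_inv y := Subtype.ext (shiftFamily_shiftFamily P _ hm (neg_neg m).symm y.1)
  right_inv x := Subtype.ext (shiftFamily_shiftFamily P hm _ rfl x.1)

end Modules

/-! ### The isomorphisms of algebras -/

section Algebras

variable (P : Params) (N : ℤ) {m : ℤ} {ε ε' : ZMod 2}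

/-- The substitution on the free algebras. -/
def freeShift (hm : ε' = ε + m) : FreeAlgebra ℂ (Gen N ε) →ₐ[ℂ] FreeAlgebra ℂ (Gen N ε') :=
  FreeAlgebra.lift ℂ (shiftFamily P hm (FreeAlgebra.ι ℂ))

/-- This is the bridge between algebras and modules: acting by a substituted expression is acting by
the original one on the pulled-back module. -/
theorem lift_freeShift {A : Type*} [Ring A] [Algebra ℂ A] (hm : ε' = ε + m)
    (y : Gen N ε' → A) (a : FreeAlgebra ℂ (Gen N ε)) :
    FreeAlgebra.lift ℂ y (freeShift P N hm a) = FreeAlgebra.lift ℂ (shiftFamily P hm y) a := by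
  have h : (FreeAlgebra.lift ℂ y).comp (freeShift P N hm) =
      FreeAlgebra.lift ℂ (shiftFamily P hm y) := by
    ext g
    simp [freeShift, shiftFamily]
  exact DFunLike.congr_fun h a

/-- The homomorphism of algebras defined by the substitution. -/
def shiftHom (hm : ε' = ε + m) : ShiftedAlgebra P N ε →ₐ[ℂ] ShiftedAlgebra P N ε' :=
  (sameAction P N ε).liftₐ (((sameAction P N ε').mkₐ (α := ℂ)).comp (freeShift P N hm))
    -- Every admissible module for `ε'` pulls back to one for `ε`, on which `a` and `b` act equally
    -- by `hab`.
    fun a b hab => Quotient.sound fun W _ _ 𝒲 y hy =>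
      (lift_freeShift P N hm y a).trans
        ((hab W 𝒲 _ (hy.shift hm)).trans (lift_freeShift P N hm y b).symm)

theorem shiftHom_gen (hm : ε' = ε + m) :
    (fun g => shiftHom P N hm (gen P N ε g)) = shiftFamily P hm (gen P N ε') := by
  funext g
  have h : shiftHom P N hm (gen P N ε g) =
      (sameAction P N ε').mkₐ (α := ℂ) (freeShift P N hm (FreeAlgebra.ι ℂ g)) := rfl
  rw [h, freeShift, FreeAlgebra.lift_ι_apply]
  simp only [shiftFamily, map_smul]
  rfl

variable {P N} in
theorem algHom_ext_gen {A : Type*} [Ring A] [Algebra ℂ A] {φ φ' : ShiftedAlgebra P N ε →ₐ[ℂ] A}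
    (h : ∀ g, φ (gen P N ε g) = φ' (gen P N ε g)) : φ = φ' := by
  apply RingCon.Quotient.hom_extₐ
  ext g
  exact h g

theorem shiftHom_comp {m' : ℤ} (hm : ε' = ε + m) (hm' : ε = ε' + m') (h : m' = -m) :
    (shiftHom P N hm').comp (shiftHom P N hm) = AlgHom.id ℂ _ := by
  apply algHom_ext_gen
  intro g
  rw [AlgHom.comp_apply, congrFun (shiftHom_gen P N hm) g, shiftFamily, map_smul,
    congrFun (shiftHom_gen P N hm') (g.shift hm)]
  exact congrFun (shiftFamily_shiftFamily P hm hm' h (gen P N ε)) g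

/-- The isomorphism of algebras defined by the substitution. -/
def shiftEquiv (hm : ε' = ε + m) : ShiftedAlgebra P N ε ≃ₐ[ℂ] ShiftedAlgebra P N ε' :=
  AlgEquiv.ofAlgHom (shiftHom P N hm) (shiftHom P N (parity_symm hm))
    (shiftHom_comp P N _ hm (neg_neg m).symm) (shiftHom_comp P N hm _ rfl)

theorem isShift_shiftEquiv (hm : ε' = ε + m) :
    IsShift P m (fun g => shiftEquiv P N hm (gen P N ε g)) (gen P N ε') := by
  have h := isShift_shiftFamily P hm (gen P N ε')
  rwa [← shiftHom_gen] at h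

/-! ### Compatibility with degree and weight. -/

theorem shiftHom_prod (hm : ε' = ε + m) (u : List (Gen N ε)) :
    shiftHom P N hm (u.map (gen P N ε)).prod = (u.map (shiftScalar P m)).prod •
      ((u.map (Gen.shift hm)).map (gen P N ε')).prod := by
  induction u with
  | nil => simp
  | cons g u ih =>
    simp only [List.map_cons, List.prod_cons, map_mul]
    rw [ih, congrFun (shiftHom_gen P N hm) g, shiftFamily, smul_mul_smul_comm]

theorem map_shiftHom_homogeneous_le (hm : ε' = ε + m) (d w : ℤ) :
    (homogeneous P N ε d w).map (shiftHom P N hm).toLinearMap ≤ homogeneous P N ε' d w := by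
  rw [homogeneous, Submodule.map_span, Submodule.span_le]
  rintro _ ⟨_, ⟨u, hd, hw, rfl⟩, rfl⟩
  rw [AlgHom.toLinearMap_apply, shiftHom_prod]
  refine Submodule.smul_mem _ _ (Submodule.subset_span ⟨u.map (Gen.shift hm), ?_, ?_, rfl⟩)
  · rw [List.map_map, ← hd]
    exact congrArg List.sum (List.map_congr_left fun g _ => Gen.deg_shift hm g)
  · rw [List.map_map, ← hw]
    exact congrArg List.sum (List.map_congr_left fun g _ => Gen.wt_shift hm g)

theorem map_shiftEquiv_homogeneous (hm : ε' = ε + m) (d w : ℤ) :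
    (homogeneous P N ε d w).map (shiftEquiv P N hm).toLinearMap = homogeneous P N ε' d w := by
  refine le_antisymm (map_shiftHom_homogeneous_le P N hm d w) fun a ha => ?_
  -- The reverse inclusion is the forward one for the opposite shift.
  exact ⟨(shiftEquiv P N hm).symm a,
    map_shiftHom_homogeneous_le P N (parity_symm hm) d w ⟨a, ha, rfl⟩,
    (shiftEquiv P N hm).apply_symm_apply a⟩

end Algebras

end ShiftedToroidal

end

theorem lemma5p1 (P : Params) (N : ℤ) :
    -- the isomorphism of algebras `A_N⁻ → A_N`
    (∃ φ : AlgAminus P N ≃ₐ[ℂ] AlgA P N,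
      IsShift P 1 (fun g => φ (gen P N 1 g)) (gen P N 0) ∧
      ∀ d w, (homogeneous P N 1 d w).map φ.toLinearMap = homogeneous P N 0 d w) ∧
    -- the automorphism of `A_N`
    (∃ φ : AlgA P N ≃ₐ[ℂ] AlgA P N,
      IsShift P 2 (fun g => φ (gen P N 0 g)) (gen P N 0) ∧
      ∀ d w, (homogeneous P N 0 d w).map φ.toLinearMap = homogeneous P N 0 d w) ∧
    -- the same substitutions on the module structures carried by any bigraded space
    (∀ (W : Type*) [AddCommGroup W] [Module ℂ W] (𝒲 : ℤ × ℤ → Submodule ℂ W),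
      (∃ Φ : {y : Gen N 0 → Module.End ℂ W // IsAdmissibleModule P N 0 𝒲 y} ≃
          {x : Gen N 1 → Module.End ℂ W // IsAdmissibleModule P N 1 𝒲 x},
        ∀ y, IsShift P 1 (Φ y).1 y.1) ∧
      (∃ Φ : {y : Gen N 0 → Module.End ℂ W // IsAdmissibleModule P N 0 𝒲 y} ≃
          {x : Gen N 0 → Module.End ℂ W // IsAdmissibleModule P N 0 𝒲 x},
        ∀ y, IsShift P 2 (Φ y).1 y.1)) := by
  -- The source is `ε` and the target `ε'`: a half-integer shift, `m = 1`, exchanges the two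
  -- parities, while `m = 2` preserves them.
  have h1 : (0 : ZMod 2) = 1 + (1 : ℤ) := by decide
  have h2 : (0 : ZMod 2) = 0 + (2 : ℤ) := by decide
  exact ⟨⟨shiftEquiv P N h1, isShift_shiftEquiv P N h1, map_shiftEquiv_homogeneous P N h1⟩,
    ⟨shiftEquiv P N h2, isShift_shiftEquiv P N h2, map_shiftEquiv_homogeneous P N h2⟩,
    fun W _ _ 𝒲 => ⟨⟨admissibleEquiv P N h1 𝒲, fun y => isShift_shiftFamily P h1 y.1⟩,
      ⟨admissibleEquiv P N h2 𝒲, fun y => isShift_shiftFamily P h2 y.1⟩⟩⟩
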